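/- Let $\kappa$ be an infinite regular cardinal (the case $\kappa=\infty$ is included by letting $\kappa$ be the size of a universe, an inaccessible cardinal of the next universe). "$\kappa$-ary" means "of size $<\kappa$". A $\kappa$-Boolean algebra is a Boolean algebra with $\kappa$-ary joins; it is $\kappa$-presented if it can be presented by $<\kappa$ generators and $<\kappa$ relations. A $\kappa$-Borel locale $X$ is a $\kappa$-Boolean algebra $\mathcal B_\kappa(X)$, whose elements are the $\kappa$-Borel sets of $X$; we write $\subseteq,\cap,\emptyset,X$ for $\le,\wedge,\bot,\top$ in it. A $\kappa$-Borel map $f:X\to Y$ is a homomorphism $f^*:\mathcal B_\kappa(Y)\to\mathcal B_\kappa(X)$ preserving the Boolean operations and $\kappa$-ary joins; it is a surjection if $f^*$ is injective, and an embedding if $f^*$ is surjective. $X$ is standard if $\mathcal B_\kappa(X)$ is $\kappa$-presented, and empty if $\mathcal B_\kappa(X)$ has one element. $X$ is analytic if it is the image of a $\kappa$-Borel map $p:Y\to Z$ between standard $\kappa$-Borel locales, i.e. $p$ factors as a surjection $Y\to X$ followed by an embedding $X\to Z$. A $\kappa$-analytic set of an analytic $\kappa$-Borel locale $X$ is a subobject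 of $X$ in the category of analytic $\kappa$-Borel locales and $\kappa$-Borel maps; these are ordered by inclusion, with least element $\emptyset$ and greatest element $X$, and intersections of them are meets in this order. A $\kappa$-Borel set $B$ of $X$ is regarded as the $\kappa$-analytic set given by the $\kappa$-Borel locale with algebra $\{C\in\mathcal B_\kappa(X) : C\subseteq B\}$ and the inclusion map with inverse image $C\mapsto B\cap C$. (1) (Novikov separation, for maps) Let $f_i:Y_i\to X$ be $<\kappa$-many $\kappa$-Borel maps between standard $\kappa$-Borel locales. If the fiber product of all the $Y_i$ over $X$ is empty, then there are $B_i\in\mathcal B_\kappa(X)$ with $\bigcap_i B_i=\emptyset$ and $f_i^*(B_i)=Y_i$ for each $i$. Let now $X$ be an analytic $\kappa$-Borel locale. (2) (Novikov separation) Let $A_i\subseteq X$ be $<\kappa$-many $\kappa$-analytic sets. If $\bigcap_i A_i=\emptyset$, then there are $\kappa$-Borel sets $B_i$ of $X$ with $A_i\subseteq B_i$ for each $i$ and $\bigcap_i B_i=\emptyset$. (3) (Lusin separation) If $A_1,A_2\subseteq X$ are disjoint $\kappa$-analytic sets, then there is a $\kappa$-Borel set $B$ of $X$ with $A_1\subseteq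 B$ and $A_2\cap B=\emptyset$. (4) (Suslin's theorem) $\mathcal B_\kappa(X)$ is order-embedded in the poset of $\kappa$-analytic sets of $X$, and the $\kappa$-Borel sets of $X$ are exactly the complemented $\kappa$-analytic sets, i.e. the $\kappa$-analytic sets $A$ for which there is a $\kappa$-analytic set $A'$ with $A\wedge A'=\emptyset$ and $A\vee A'=X$. -/

import Mathlib

open CategoryTheory CategoryTheory.Limits
open scoped Cardinal

universe u

/-! ### `κ`-Boolean algebras -/

/-- A Boolean algebra with all `κ`-ary (i.e. of size `< κ`) joins. -/
class KComplete (κ : Cardinal.{u}) (A : Type u) [BooleanAlgebra A] : Prop where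
  exists_isLUB : ∀ s : Set A, #s < κ → ∃ a, IsLUB s a

/-- Homomorphisms of `κ`-Boolean algebras: Boolean homomorphisms preserving `κ`-ary joins. -/
structure KBoolHom (κ : Cardinal.{u}) (A B : Type u) [BooleanAlgebra A] [BooleanAlgebra B]
    extends BoundedLatticeHom A B where
  map_isLUB' : ∀ (s : Set A) (a : A), #s < κ → IsLUB s a → IsLUB (toFun '' s) (toFun a)

namespace KBoolHom

variable {κ : Cardinal.{u}} {A B C : Type u} [BooleanAlgebra A] [BooleanAlgebra B]
  [BooleanAlgebra C]

instance : FunLike (KBoolHom κ A B) A B where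
  coe f := f.toFun
  coe_injective f g h := by
    obtain ⟨⟨⟨⟨f, _⟩, _⟩, _, _⟩, _⟩ := f
    obtain ⟨⟨⟨⟨g, _⟩, _⟩, _, _⟩, _⟩ := g
    simp only at h
    subst h
    rfl

instance : BoundedLatticeHomClass (KBoolHom κ A B) A B where
  map_sup f := f.map_sup'
  map_inf f := f.map_inf'
  map_top f := f.map_top'
  map_bot f := f.map_bot'

@[ext]
theorem ext {f g : KBoolHom κ A B} (h : ∀ a, f a = g a) : f = g :=
  DFunLike.ext f g h

theorem map_isLUB (f : KBoolHom κ A B) {s : Set A} {a : A} (hs : #s < κ) (h : IsLUB s a) :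
    IsLUB (f '' s) (f a) :=
  f.map_isLUB' s a hs h

/-- The identity homomorphism. -/
def id (κ : Cardinal.{u}) (A : Type u) [BooleanAlgebra A] : KBoolHom κ A A where
  toBoundedLatticeHom := BoundedLatticeHom.id A
  map_isLUB' s a _ h := by
    change IsLUB ((fun x => x) '' s) a
    simpa using h

/-- Composition of homomorphisms. -/
def comp (g : KBoolHom κ B C) (f : KBoolHom κ A B) : KBoolHom κ A C where
  toBoundedLatticeHom := g.toBoundedLatticeHom.comp f.toBoundedLatticeHom
  map_isLUB' s a hs h := by
    have h1 := g.map_isLUB (lt_of_le_of_lt Cardinal.mk_image_le hs) (f.map_isLUB hs h)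
    rw [Set.image_image] at h1
    exact h1

@[simp] theorem id_apply (a : A) : KBoolHom.id κ A a = a := rfl

@[simp] theorem comp_apply (g : KBoolHom κ B C) (f : KBoolHom κ A B) (a : A) :
    g.comp f a = g (f a) := rfl

end KBoolHom

/-- `i : G → F` exhibits `F` as the free `κ`-Boolean algebra on the set of generators `G`. -/
def IsFreeKBool (κ : Cardinal.{u}) {G F : Type u} [BooleanAlgebra F] (i : G → F) : Prop :=
  ∀ (B : Type u) [BooleanAlgebra B] [KComplete κ B] (v : G → B),
    ∃! h : KBoolHom κ F B, ∀ g, h (i g) = v g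

/-- `q : F → A` exhibits `A` as the quotient of the `κ`-Boolean algebra `F` by the relations
`r.1 = r.2`, `r ∈ R`. -/
def IsQuotientByRelations {κ : Cardinal.{u}} {F A : Type u} [BooleanAlgebra F] [BooleanAlgebra A]
    (q : KBoolHom κ F A) (R : Set (F × F)) : Prop :=
  Function.Surjective q ∧ (∀ r ∈ R, q r.1 = q r.2) ∧
    ∀ (B : Type u) [BooleanAlgebra B] [KComplete κ B] (h : KBoolHom κ F B),
      (∀ r ∈ R, h r.1 = h r.2) → ∃ k : KBoolHom κ A B, k.comp q = h

/-- `A` is a `κ`-presented `κ`-Boolean algebra: it is presented by fewer than `κ` generators and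
fewer than `κ` relations. -/
def IsKPresented (κ : Cardinal.{u}) (A : Type u) [BooleanAlgebra A] : Prop :=
  ∃ (G F : Type u) (_ : BooleanAlgebra F) (_ : KComplete κ F) (i : G → F)
    (R : Set (F × F)) (q : KBoolHom κ F A),
    #G < κ ∧ #R < κ ∧ IsFreeKBool κ i ∧ IsQuotientByRelations q R

/-! ### Principal quotients `↓b` of a `κ`-Boolean algebra -/

section Iic

variable {A : Type u} [BooleanAlgebra A]

instance iicBooleanAlgebra (b : A) : BooleanAlgebra (Set.Iic b) where
  __ := (inferInstance : Lattice (Set.Iic b))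
  __ := (inferInstance : BoundedOrder (Set.Iic b))
  le_sup_inf x y z := by
    change (x.1 ⊔ y.1) ⊓ (x.1 ⊔ z.1) ≤ x.1 ⊔ y.1 ⊓ z.1
    exact le_sup_inf
  compl x := ⟨x.1ᶜ ⊓ b, inf_le_right⟩
  inf_compl_le_bot x := by
    change x.1 ⊓ (x.1ᶜ ⊓ b) ≤ ⊥
    rw [← inf_assoc, inf_compl_self, bot_inf_eq]
  top_le_sup_compl x := by
    change b ≤ x.1 ⊔ x.1ᶜ ⊓ b
    rw [sup_inf_left, sup_compl_eq_top, top_inf_eq]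
    exact le_sup_right

theorem isLUB_coe_image {b : A} {s : Set (Set.Iic b)} {a : Set.Iic b} :
    IsLUB ((fun x : Set.Iic b => x.1) '' s) a.1 ↔ IsLUB s a := by
  constructor
  · intro h
    refine ⟨fun x hx => h.1 ⟨x, hx, rfl⟩, fun c hc => h.2 ?_⟩
    rintro _ ⟨x, hx, rfl⟩
    exact hc hx
  · intro h
    constructor
    · rintro _ ⟨x, hx, rfl⟩
      exact h.1 hx
    · intro c hc
      have h2 : a ≤ ⟨c ⊓ b, inf_le_right⟩ :=
        h.2 fun x hx => (le_inf (hc ⟨x, hx, rfl⟩) x.2 : x.1 ≤ c ⊓ b)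
      exact le_trans (show a.1 ≤ c ⊓ b from h2) inf_le_left

instance iicKComplete {κ : Cardinal.{u}} [KComplete κ A] (b : A) : KComplete κ (Set.Iic b) where
  exists_isLUB s hs := by
    obtain ⟨a, ha⟩ := KComplete.exists_isLUB (κ := κ) ((fun x : Set.Iic b => x.1) '' s)
      (lt_of_le_of_lt Cardinal.mk_image_le hs)
    have hab : a ≤ b := ha.2 (by rintro _ ⟨x, _, rfl⟩; exact x.2)
    exact ⟨⟨a, hab⟩, isLUB_coe_image.1 ha⟩

/-- The quotient homomorphism `b ⊓ - : A → ↓b`. -/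
def restrictHom (κ : Cardinal.{u}) (b : A) : KBoolHom κ A (Set.Iic b) where
  toFun x := ⟨b ⊓ x, inf_le_left⟩
  map_sup' x y := Subtype.ext (inf_sup_left b x y)
  map_inf' x y := Subtype.ext (inf_inf_distrib_left b x y)
  map_top' := Subtype.ext (inf_top_eq b)
  map_bot' := Subtype.ext (inf_bot_eq b)
  map_isLUB' s a _ h := by
    constructor
    · rintro _ ⟨x, hx, rfl⟩
      exact (inf_le_inf_left b (h.1 hx) : b ⊓ x ≤ b ⊓ a)
    · intro c hc
      have h1 : a ≤ b ⇨ c.1 := h.2 fun x hx => by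
        rw [le_himp_iff, inf_comm]
        exact (hc ⟨x, hx, rfl⟩ : b ⊓ x ≤ c.1)
      rw [le_himp_iff, inf_comm] at h1
      exact h1

theorem restrictHom_surjective (κ : Cardinal.{u}) (b : A) :
    Function.Surjective (restrictHom κ b) :=
  fun x => ⟨x.1, Subtype.ext (inf_eq_right.2 x.2)⟩

/-- A homomorphism sending `b` to `⊤` factors through `↓b`. -/
def descendHom {κ : Cardinal.{u}} {B : Type u} [BooleanAlgebra B] (k : KBoolHom κ A B) (b : A)
    (hb : k b = ⊤) : KBoolHom κ (Set.Iic b) B where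
  toFun x := k x.1
  map_sup' x y := map_sup k x.1 y.1
  map_inf' x y := map_inf k x.1 y.1
  map_top' := hb
  map_bot' := map_bot k
  map_isLUB' s a hs h := by
    have h1 := k.map_isLUB (lt_of_le_of_lt Cardinal.mk_image_le hs) (isLUB_coe_image.2 h)
    rw [Set.image_image] at h1
    exact h1

theorem descendHom_restrictHom {κ : Cardinal.{u}} {B : Type u} [BooleanAlgebra B]
    (k : KBoolHom κ A B) (b : A) (hb : k b = ⊤) (x : A) :
    descendHom k b hb (restrictHom κ b x) = k x := by
  change k (b ⊓ x) = k x
  rw [map_inf, hb, top_inf_eq]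

theorem IsKPresented.iic {κ : Cardinal.{u}} [hκ : Fact κ.IsRegular] (hA : IsKPresented κ A)
    (b : A) : IsKPresented κ (Set.Iic b) := by
  obtain ⟨G, F, _, _, i, R, q, hG, hR, hi, hq, hqR, hu⟩ := hA
  obtain ⟨f, rfl⟩ := hq b
  refine ⟨G, F, inferInstance, inferInstance, i, insert (f, ⊤) R, (restrictHom κ (q f)).comp q,
    hG, ?_, hi, (restrictHom_surjective κ _).comp hq, ?_, ?_⟩
  · exact lt_of_le_of_lt Cardinal.mk_insert_le
      (Cardinal.add_lt_of_lt hκ.out.1 hR (lt_of_lt_of_le Cardinal.one_lt_aleph0 hκ.out.1))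
  · intro r hr
    rcases hr with rfl | hr
    · refine Subtype.ext ?_
      change q f ⊓ q f = q f ⊓ q ⊤
      rw [map_top, inf_top_eq, inf_idem]
    · simp only [KBoolHom.comp_apply, hqR r hr]
  · intro B _ _ h hh
    obtain ⟨k, hk⟩ := hu B h fun r hr => hh r (Set.mem_insert_of_mem _ hr)
    have hkq : ∀ x, k (q x) = h x := fun x => DFunLike.congr_fun hk x
    have htop : k (q f) = ⊤ := by
      rw [hkq, hh (f, ⊤) (Set.mem_insert _ _), map_top]
    refine ⟨descendHom k (q f) htop, ?_⟩
    ext x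
    rw [KBoolHom.comp_apply, KBoolHom.comp_apply, descendHom_restrictHom, hkq]

end Iic

/-! ### `κ`-Borel locales -/

/-- A `κ`-Borel locale `X` is an arbitrary `κ`-Boolean algebra `X.Borel`, whose elements are the
`κ`-Borel sets of `X`.

The cardinal `κ` lives in the same, arbitrary, universe as the algebra.  Hence "`κ = ∞`", i.e.
large complete Boolean algebras with all small joins, is the case `κ = Cardinal.univ.{u, u + 1}`,
an inaccessible cardinal in the universe `u + 1`. -/
structure BorelLocale (κ : Cardinal.{u}) where
  Borel : Type u
  [booleanAlgebra : BooleanAlgebra Borel]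
  [kComplete : KComplete κ Borel]

attribute [instance] BorelLocale.booleanAlgebra BorelLocale.kComplete

/-- A `κ`-Borel map `f : X ⟶ Y` is a homomorphism `f.preimage` of `κ`-Boolean algebras from the
`κ`-Borel sets of `Y` to those of `X`. -/
@[ext]
structure BorelMap {κ : Cardinal.{u}} (X Y : BorelLocale κ) where
  preimage : KBoolHom κ Y.Borel X.Borel

instance BorelLocale.category (κ : Cardinal.{u}) : Category (BorelLocale κ) where
  Hom X Y := BorelMap X Y
  id X := ⟨KBoolHom.id κ X.Borel⟩
  comp f g := ⟨f.preimage.comp g.preimage⟩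

/-- A `κ`-Borel locale is standard if its algebra of `κ`-Borel sets is `κ`-presented. -/
def BorelLocale.IsStandard {κ : Cardinal.{u}} (X : BorelLocale κ) : Prop :=
  IsKPresented κ X.Borel

/-- The empty locale is the one with the one-element algebra. -/
def BorelLocale.IsEmptyLocale {κ : Cardinal.{u}} (X : BorelLocale κ) : Prop :=
  Subsingleton X.Borel

/-- `κ`-Borel surjections (quotient maps of `κ`-Borel locales). -/
def IsBorelSurjection {κ : Cardinal.{u}} {X Y : BorelLocale κ} (f : X ⟶ Y) : Prop :=
  Function.Injective (BorelMap.preimage f)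

/-- `κ`-Borel embeddings: every `κ`-Borel set of `X` is the restriction of one of `Y`. -/
def IsBorelEmbedding {κ : Cardinal.{u}} {X Y : BorelLocale κ} (f : X ⟶ Y) : Prop :=
  Function.Surjective (BorelMap.preimage f)

/-- `X` is an analytic `κ`-Borel locale: it is the image of a `κ`-Borel map `p` between standard
`κ`-Borel locales, i.e. `p` factors as a `κ`-Borel surjection onto `X` followed by a `κ`-Borel
embedding of `X`. -/
def BorelLocale.IsAnalytic (κ : Cardinal.{u}) : ObjectProperty (BorelLocale κ) := fun X =>
  ∃ (Y Z : BorelLocale κ) (p : Y ⟶ Z) (e : Y ⟶ X) (m : X ⟶ Z),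
    Y.IsStandard ∧ Z.IsStandard ∧ e ≫ m = p ∧ IsBorelSurjection e ∧ IsBorelEmbedding m

/-- The category of analytic `κ`-Borel locales, a full subcategory of `κ`-Borel locales. -/
abbrev AnalyticBorelLocale (κ : Cardinal.{u}) := (BorelLocale.IsAnalytic κ).FullSubcategory

/-- The `κ`-Borel sets of an analytic `κ`-Borel locale. -/
abbrev BorelSet {κ : Cardinal.{u}} (X : AnalyticBorelLocale κ) : Type u := X.obj.Borel

/-- The `κ`-analytic sets in an analytic `κ`-Borel locale `X`: its subobjects in the category of
analytic `κ`-Borel locales, ordered by inclusion. -/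
abbrev AnalyticSet {κ : Cardinal.{u}} (X : AnalyticBorelLocale κ) := Subobject X

/-! ### `κ`-Borel sets as `κ`-analytic sets -/

section OfBorel

variable {κ : Cardinal.{u}}

/-- A `κ`-Borel set `b` of `X`, regarded as a `κ`-Borel locale, with `κ`-Borel sets `↓b`. -/
def BorelLocale.sub (X : BorelLocale κ) (b : X.Borel) : BorelLocale κ where
  Borel := Set.Iic b

/-- The inclusion `b ↪ X`, with inverse image `c ↦ b ∩ c`. -/
def BorelLocale.subι (X : BorelLocale κ) (b : X.Borel) : X.sub b ⟶ X :=
  BorelMap.mk (restrictHom κ b)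

/-- The inclusion `X ↪ Z` and surjection `Y ↠ X` restrict to `b ↪ Z` and `e⁻¹ b ↠ b`. -/
theorem BorelLocale.isAnalytic_sub [Fact κ.IsRegular] (X : BorelLocale κ)
    (hX : BorelLocale.IsAnalytic κ X) (b : X.Borel) : BorelLocale.IsAnalytic κ (X.sub b) := by
  obtain ⟨Y, Z, p, e, m, hY, hZ, -, he, hm⟩ := hX
  let e' : KBoolHom κ X.Borel Y.Borel := BorelMap.preimage e
  have he' : Function.Injective e' := he
  have htop : (restrictHom κ (e' b)).comp e' b = ⊤ := Subtype.ext (inf_idem (e' b))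
  let k : Y.sub (e' b) ⟶ X.sub b :=
    BorelMap.mk (descendHom ((restrictHom κ (e' b)).comp e') b htop)
  refine ⟨Y.sub (e' b), Z, k ≫ (X.subι b ≫ m), k, X.subι b ≫ m, hY.iic _, hZ, rfl, ?_, ?_⟩
  · intro x y hxy
    have h1 : e' b ⊓ e' x.1 = e' b ⊓ e' y.1 := congrArg Subtype.val hxy
    rw [← map_inf, ← map_inf, inf_eq_right.2 x.2, inf_eq_right.2 y.2] at h1
    exact Subtype.ext (he' h1)
  · exact (restrictHom_surjective κ b).comp hm

variable [Fact κ.IsRegular]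

/-- A `κ`-Borel set of `X` as an analytic `κ`-Borel locale. -/
def AnalyticBorelLocale.sub (X : AnalyticBorelLocale κ) (b : BorelSet X) :
    AnalyticBorelLocale κ where
  obj := X.obj.sub b
  property := X.obj.isAnalytic_sub X.property b

/-- The inclusion of a `κ`-Borel set. -/
def AnalyticBorelLocale.subι (X : AnalyticBorelLocale κ) (b : BorelSet X) : X.sub b ⟶ X :=
  ObjectProperty.homMk (X.obj.subι b)

instance AnalyticBorelLocale.mono_subι (X : AnalyticBorelLocale κ) (b : BorelSet X) :
    Mono (X.subι b) where
  right_cancellation {Z} g h w := by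
    apply ObjectProperty.hom_ext
    refine BorelMap.ext (KBoolHom.ext fun x => ?_)
    obtain ⟨y, rfl⟩ := restrictHom_surjective κ b x
    exact DFunLike.congr_fun (congrArg (fun t => BorelMap.preimage t.hom) w) y

/-- A `κ`-Borel set `b` of `X`, regarded as a `κ`-analytic set. -/
noncomputable def AnalyticSet.ofBorel {X : AnalyticBorelLocale κ} (b : BorelSet X) :
    AnalyticSet X :=
  Subobject.mk (X.subι b)

theorem AnalyticSet.ofBorel_bot_le {X : AnalyticBorelLocale κ} (A : AnalyticSet X) :
    AnalyticSet.ofBorel ⊥ ≤ A := by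
  have hs : ∀ x y : Set.Iic (⊥ : BorelSet X), x = y := fun x y =>
    Subtype.ext ((le_bot_iff.1 x.2).trans (le_bot_iff.1 y.2).symm)
  let k : KBoolHom κ (A : AnalyticBorelLocale κ).obj.Borel (Set.Iic (⊥ : BorelSet X)) :=
    { toFun := fun _ => ⊥
      map_sup' := fun _ _ => hs _ _
      map_inf' := fun _ _ => hs _ _
      map_top' := hs _ _
      map_bot' := rfl
      map_isLUB' := fun s a _ _ =>
        ⟨fun x _ => (hs x _).le, fun x _ => (hs _ x).le⟩ }
  let g : X.sub ⊥ ⟶ (A : AnalyticBorelLocale κ) :=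
    ObjectProperty.homMk (P := BorelLocale.IsAnalytic κ)
      (show X.obj.sub ⊥ ⟶ (A : AnalyticBorelLocale κ).obj from BorelMap.mk k)
  refine Subobject.mk_le_of_comm g ?_
  apply ObjectProperty.hom_ext
  exact BorelMap.ext (KBoolHom.ext fun x => hs _ _)

/-- The least `κ`-analytic set is the empty set, the greatest one is `X`. -/
noncomputable instance AnalyticSet.boundedOrder (X : AnalyticBorelLocale κ) :
    BoundedOrder (AnalyticSet X) where
  __ := (inferInstance : OrderTop (Subobject X))
  bot := AnalyticSet.ofBorel ⊥
  bot_le := AnalyticSet.ofBorel_bot_le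

end OfBorel

/-! The core is an amalgamation theorem: homomorphisms `f i : A → B i` that cannot be separated by
elements of `A` with empty meet have a nontrivial common extension. It is a forcing argument. The
conditions are the families `p`, with `p i : B i`, that cannot be separated; the extension is the
complete Boolean algebra of regular lower sets of this poset, and `x : B i` goes to the double
negation of `{p | p i ≤ x}`. Two refinement lemmas, `BorelSeparated.of_isLUB` and
`BorelSeparated.of_update_inf_map`, give by density the preservation of `κ`-ary joins and the
agreement of the composites from `A`. For maps, this extension is a nonempty cone over the fiber
product, which proves (1).

For analytic sets the extension must be `κ`-presented. Over `κ`-presented data, fewer than `κ`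
equations between generators describe an amalgam; their meet cuts a principal quotient out of a free
algebra, and this quotient is nontrivial because it maps to the forcing extension. Applied to a
Borel set and its complement, this shows that monomorphisms are embeddings, so an analytic set is
determined by the Borel sets containing it. Novikov separation follows, since the image of a
nonempty standard amalgam would be a nonempty analytic set inside every `A i`. Lusin separation is
the binary case, and it yields Suslin's theorem. -/

/-! ### `κ`-ary joins and meets of families -/

section Joins

variable {κ : Cardinal.{u}} {A B C : Type u} [BooleanAlgebra A] [BooleanAlgebra B]
  [BooleanAlgebra C] {ι : Type u}

/-- The join of a `κ`-ary family. -/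
noncomputable def kSup [KComplete κ A] (hι : #ι < κ) (f : ι → A) : A :=
  (KComplete.exists_isLUB (Set.range f) (Cardinal.mk_range_le.trans_lt hι)).choose

theorem isLUB_kSup [KComplete κ A] (hι : #ι < κ) (f : ι → A) :
    IsLUB (Set.range f) (kSup hι f) :=
  (KComplete.exists_isLUB (Set.range f) (Cardinal.mk_range_le.trans_lt hι)).choose_spec

theorem isGLB_range_iff_isLUB_compl {f : ι → A} {a : A} :
    IsGLB (Set.range f) a ↔ IsLUB (Set.range fun i => (f i)ᶜ) aᶜ := by
  constructor
  · refine fun h => ⟨?_, fun c hc => compl_le_iff_compl_le.2 (h.2 ?_)⟩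
    · rintro _ ⟨i, rfl⟩
      exact compl_le_compl (h.1 ⟨i, rfl⟩)
    · rintro _ ⟨i, rfl⟩
      exact compl_le_iff_compl_le.1 (hc ⟨i, rfl⟩)
  · refine fun h => ⟨?_, fun c hc => compl_le_compl_iff_le.1 (h.2 ?_)⟩
    · rintro _ ⟨i, rfl⟩
      exact compl_le_compl_iff_le.1 (h.1 ⟨i, rfl⟩)
    · rintro _ ⟨i, rfl⟩
      exact compl_le_compl (hc ⟨i, rfl⟩)

/-- The meet of a `κ`-ary family. -/
noncomputable def kInf [KComplete κ A] (hι : #ι < κ) (f : ι → A) : A :=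
  (kSup hι fun i => (f i)ᶜ)ᶜ

theorem isGLB_kInf [KComplete κ A] (hι : #ι < κ) (f : ι → A) :
    IsGLB (Set.range f) (kInf hι f) := by
  rw [isGLB_range_iff_isLUB_compl, kInf, compl_compl]
  exact isLUB_kSup hι _

theorem kInf_le [KComplete κ A] (hι : #ι < κ) (f : ι → A) (i : ι) : kInf hι f ≤ f i :=
  (isGLB_kInf hι f).1 ⟨i, rfl⟩

theorem KBoolHom.map_isLUB_range (h : KBoolHom κ A B) (hι : #ι < κ) {f : ι → A} {a : A}
    (ha : IsLUB (Set.range f) a) : IsLUB (Set.range fun i => h (f i)) (h a) := by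
  have h1 := h.map_isLUB (Cardinal.mk_range_le.trans_lt hι) ha
  rwa [← Set.range_comp] at h1

theorem KBoolHom.map_isGLB_range (h : KBoolHom κ A B) (hι : #ι < κ) {f : ι → A} {a : A}
    (ha : IsGLB (Set.range f) a) : IsGLB (Set.range fun i => h (f i)) (h a) := by
  rw [isGLB_range_iff_isLUB_compl] at ha ⊢
  simpa only [map_compl'] using h.map_isLUB_range hι ha

theorem isGLB_range_bot_iff {f : ι → A} :
    IsGLB (Set.range f) ⊥ ↔ ∀ x, (∀ i, x ≤ f i) → x = ⊥ := by
  constructor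
  · intro h x hx
    exact le_bot_iff.1 (h.2 (by rintro _ ⟨i, rfl⟩; exact hx i))
  · intro h
    exact ⟨fun _ _ => bot_le, fun x hx => (h x fun i => hx ⟨i, rfl⟩).le⟩

/-- Binary meets distribute over arbitrary existing joins. -/
theorem IsLUB.inf_le_of_forall {s : Set A} {a b c : A} (h : IsLUB s a)
    (hc : ∀ x ∈ s, b ⊓ x ≤ c) : b ⊓ a ≤ c := by
  rw [inf_comm, ← le_himp_iff]
  exact h.2 fun x hx => by rw [le_himp_iff, inf_comm]; exact hc x hx

/-- A map preserving finite meets and `κ`-ary joins is a homomorphism. -/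
def KBoolHom.ofIsLUB (hκ : ℵ₀ ≤ κ) (f : A → B) (htop : f ⊤ = ⊤)
    (hinf : ∀ x y, f (x ⊓ y) = f x ⊓ f y)
    (hlub : ∀ (s : Set A) (a : A), #s < κ → IsLUB s a → IsLUB (f '' s) (f a)) :
    KBoolHom κ A B where
  toFun := f
  map_sup' x y := by
    have h : #({x, y} : Set A) < κ :=
      (Cardinal.lt_aleph0_iff_set_finite.2 (Set.toFinite _)).trans_le hκ
    have h1 := hlub _ _ h isLUB_pair
    rw [Set.image_pair] at h1
    exact h1.unique isLUB_pair
  map_inf' := hinf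
  map_top' := htop
  map_bot' := by
    have h : #(∅ : Set A) < κ :=
      (Cardinal.lt_aleph0_iff_set_finite.2 Set.finite_empty).trans_le hκ
    have h1 := hlub ∅ ⊥ h isLUB_empty
    rw [Set.image_empty] at h1
    exact isLUB_empty_iff.1 h1 |>.eq_bot
  map_isLUB' := hlub

/-- A homomorphism whose kernel contains that of a surjection `q` factors through `q`. -/
theorem KBoolHom.exists_comp_eq_of_surjective [KComplete κ A] (hκ : ℵ₀ ≤ κ)
    (q : KBoolHom κ A B) (hq : Function.Surjective q) (h : KBoolHom κ A C)
    (hker : ∀ x, q x = ⊤ → h x = ⊤) : ∃ k : KBoolHom κ B C, k.comp q = h := by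
  -- Two elements are equal exactly when their biimplication is `⊤`, so the condition on `⊤`
  -- controls all identifications.
  have hqh : ∀ x y, q x = q y → h x = h y := fun x y hxy =>
    bihimp_eq_top.1 <| by
      rw [← map_bihimp]
      apply hker
      rw [map_bihimp]
      exact bihimp_eq_top.2 hxy
  have hs := Function.rightInverse_surjInv hq
  have key : ∀ x, h (Function.surjInv hq (q x)) = h x := fun x => hqh _ _ (hs _)
  refine ⟨KBoolHom.ofIsLUB hκ (fun b => h (Function.surjInv hq b)) ?_ ?_ ?_, KBoolHom.ext key⟩
  · rw [← map_top q, key, map_top]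
  · intro x y
    obtain ⟨x, rfl⟩ := hq x
    obtain ⟨y, rfl⟩ := hq y
    rw [← map_inf, key, key, key, map_inf]
  · intro s b hsκ hb
    -- A join in `B` is the image of the join in `A` of chosen preimages.
    have hs' : #(Function.surjInv hq '' s) < κ := Cardinal.mk_image_le.trans_lt hsκ
    obtain ⟨a, ha⟩ := KComplete.exists_isLUB (κ := κ) _ hs'
    have h1 := q.map_isLUB hs' ha
    have h2 := h.map_isLUB hs' ha
    rw [Set.image_image] at h1 h2
    simp only [hs _, Set.image_id'] at h1
    obtain rfl := h1.unique hb
    simpa only [key] using h2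

end Joins

/-! ### Amalgamation -/

section Amalgamation

variable {κ : Cardinal.{u}} {ι A : Type u} [BooleanAlgebra A] {B : ι → Type u}
  [∀ i, BooleanAlgebra (B i)]

/-- The elements `p i` can be separated by elements of `A` with empty meet. -/
def BorelSeparated (f : ∀ i, KBoolHom κ A (B i)) (p : ∀ i, B i) : Prop :=
  ∃ a : ι → A, (∀ i, p i ≤ f i (a i)) ∧ IsGLB (Set.range a) ⊥

/-- The poset of families that cannot be separated. -/
abbrev Unseparated (f : ∀ i, KBoolHom κ A (B i)) : Type u :=
  {p : ∀ i, B i // ¬ BorelSeparated f p}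

/-- Double negation is left adjoint to the inclusion of regular elements, so it carries joins of the
frame to joins of regular elements. -/
theorem kComplete_regular (α : Type u) [Order.Frame α] : KComplete κ (Heyting.Regular α) where
  exists_isLUB s _ := by
    have h := (Heyting.Regular.gi (α := α)).gc.isLUB_l_image
      (isLUB_sSup (Heyting.Regular.val '' s))
    rw [Set.image_image] at h
    simp only [Heyting.Regular.toRegular_coe, Set.image_id'] at h
    exact ⟨_, h⟩

/-- Given separators for each piece `x`, take their join over `x` at the index `i` and their meet at
the other indices. By distributivity the total meet lies below the join of the meets for the single
pieces, which are all `⊥`. Contrapositively, an unseparated family covered at `i` by `s` stays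
unseparated after restriction to some member of `s`. -/
theorem BorelSeparated.of_isLUB [DecidableEq ι] [KComplete κ A] {f : ∀ i, KBoolHom κ A (B i)}
    (p : ∀ i, B i) (i : ι) {s : Set (B i)} (hs : #s < κ) {b : B i} (hb : IsLUB s b)
    (hpb : p i ≤ b)
    (h : ∀ x ∈ s, BorelSeparated f (Function.update p i (p i ⊓ x))) : BorelSeparated f p := by
  choose a ha ha' using fun x : s => h x x.2
  refine ⟨Function.update (fun j => kInf hs fun x => a x j) i (kSup hs fun x => a x i), ?_, ?_⟩
  · intro j
    by_cases hj : j = i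
    · subst hj
      rw [Function.update_self, ← inf_eq_left.2 hpb]
      refine hb.inf_le_of_forall fun x hx => ?_
      have h1 := ha ⟨x, hx⟩ j
      rw [Function.update_self] at h1
      exact h1.trans (((f j).map_isLUB_range hs (isLUB_kSup hs fun x => a x j)).1 ⟨⟨x, hx⟩, rfl⟩)
    · rw [Function.update_of_ne hj]
      refine ((f j).map_isGLB_range hs (isGLB_kInf hs fun x => a x j)).2 ?_
      rintro _ ⟨x, rfl⟩
      have h1 := ha x j
      rwa [Function.update_of_ne hj] at h1
  · rw [isGLB_range_bot_iff]
    intro y hy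
    have hyi := hy i
    rw [Function.update_self] at hyi
    rw [← inf_eq_left.2 hyi, ← le_bot_iff]
    refine (isLUB_kSup hs fun x => a x i).inf_le_of_forall ?_
    rintro _ ⟨x, rfl⟩
    refine (isGLB_range_bot_iff.1 (ha' x) _ fun j => ?_).le
    by_cases hj : j = i
    · subst hj
      exact inf_le_right
    · have h1 := hy j
      rw [Function.update_of_ne hj] at h1
      exact inf_le_left.trans (h1.trans (kInf_le hs _ x))

/-- Separators `c` of the smaller family are corrected to `c i ⊓ a` at `i` and `c j ⊔ aᶜ` at `j`:
below `a` the second reduces to `c j`, so the meet remains empty. -/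
theorem BorelSeparated.of_update_inf_map [DecidableEq ι] {f : ∀ i, KBoolHom κ A (B i)}
    {p : ∀ i, B i} {i j : ι} {a : A} (hp : p i ≤ f i a)
    (h : BorelSeparated f (Function.update p j (p j ⊓ f j a))) : BorelSeparated f p := by
  obtain ⟨c, hc, hc'⟩ := h
  by_cases hij : j = i
  · subst hij
    rw [inf_eq_left.2 hp, Function.update_eq_self] at hc
    exact ⟨c, hc, hc'⟩
  have hcj := hc j
  rw [Function.update_self] at hcj
  have hcne : ∀ k ≠ j, p k ≤ f k (c k) := fun k hk => by
    have := hc k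
    rwa [Function.update_of_ne hk] at this
  refine ⟨Function.update (Function.update c i (c i ⊓ a)) j (c j ⊔ aᶜ), fun k => ?_, ?_⟩
  · by_cases hkj : k = j
    · subst hkj
      rw [Function.update_self, map_sup, map_compl', ← himp_eq, le_himp_iff]
      exact hcj
    rw [Function.update_of_ne hkj]
    by_cases hki : k = i
    · subst hki
      rw [Function.update_self, map_inf]
      exact le_inf (hcne k hkj) hp
    rw [Function.update_of_ne hki]
    exact hcne k hkj
  · rw [isGLB_range_bot_iff] at hc' ⊢
    intro x hx
    have hxi := hx i
    rw [Function.update_of_ne (Ne.symm hij), Function.update_self] at hxi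
    refine hc' x fun k => ?_
    by_cases hkj : k = j
    · subst hkj
      have h1 := hx k
      rw [Function.update_self, ← himp_eq, le_himp_iff] at h1
      exact (le_inf le_rfl (hxi.trans inf_le_right)).trans h1
    by_cases hki : k = i
    · subst hki
      exact hxi.trans inf_le_left
    have h1 := hx k
    rwa [Function.update_of_ne hkj, Function.update_of_ne hki] at h1

/-- The lower set of unseparated families contained in `x` at `i`. -/
def unseparatedBelow (f : ∀ i, KBoolHom κ A (B i)) (i : ι) (x : B i) :
    LowerSet (Unseparated f) where
  carrier := {p | p.1 i ≤ x}
  lower' _ _ hqp hp := le_trans (hqp i) hp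

/-- Density criterion: a point of both `U` and `Vᶜ` would have a refinement in both `V` and `Vᶜ`. -/
theorem Unseparated.exists_mem_of_le {f : ∀ i, KBoolHom κ A (B i)} {U V : LowerSet (Unseparated f)}
    (h : ∀ p ∈ U, ∃ q ≤ p, q ∈ V) : U ≤ Vᶜᶜ := by
  rw [le_compl_iff_disjoint_right, disjoint_iff_inf_le]
  rintro p ⟨hpU, hpV⟩
  obtain ⟨q, hqp, hq⟩ := h p hpU
  have hqV : q ∈ V ⊓ Vᶜ := ⟨hq, LowerSet.lower _ hqp hpV⟩
  exact absurd ((disjoint_compl_right (a := V)).le_bot hqV) id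

open Classical in
/-- Homomorphisms `f i : A → B i` into `κ`-Boolean algebras that are not separated have a
nontrivial amalgam: the regular lower sets of the poset of unseparated families. -/
theorem exists_amalgam (hκ : ℵ₀ ≤ κ) [KComplete κ A] (f : ∀ i, KBoolHom κ A (B i))
    (hf : ¬ BorelSeparated f fun _ => ⊤) :
    ∃ (E : Type u) (_ : BooleanAlgebra E) (_ : KComplete κ E) (g : ∀ i, KBoolHom κ (B i) E),
      Nontrivial E ∧ ∀ i j a, g i (f i a) = g j (f j a) := by
  have hupd : ∀ (p : ∀ i, B i) i x, Function.update p i (p i ⊓ x) ≤ p := fun p i x =>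
    update_le_iff.2 ⟨inf_le_left, fun _ _ => le_rfl⟩
  let g : ∀ i, B i → Heyting.Regular (LowerSet (Unseparated f)) := fun i x =>
    Heyting.Regular.toRegular (unseparatedBelow f i x)
  have hgle : ∀ i x (c : Heyting.Regular (LowerSet (Unseparated f))),
      g i x ≤ c ↔ unseparatedBelow f i x ≤ c := fun i x c =>
    Heyting.Regular.gi.gc _ _
  refine ⟨Heyting.Regular (LowerSet (Unseparated f)), inferInstance, kComplete_regular _,
    fun i => KBoolHom.ofIsLUB hκ (g i) ?_ ?_ ?_, ?_, ?_⟩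
  · have h : unseparatedBelow f i ⊤ = ⊤ := top_le_iff.1 fun p _ => (le_top : p.1 i ≤ ⊤)
    apply Heyting.Regular.coe_injective
    simp only [g, h, Heyting.Regular.coe_toRegular, Heyting.Regular.coe_top, compl_top, compl_bot]
  · intro x y
    have h : unseparatedBelow f i (x ⊓ y) = unseparatedBelow f i x ⊓ unseparatedBelow f i y :=
      SetLike.ext fun p => le_inf_iff
    apply Heyting.Regular.coe_injective
    change _ = (g i x).val ⊓ (g i y).val
    simp only [g, h, Heyting.Regular.coe_toRegular, compl_compl_inf_distrib]
  · intro s a hs ha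
    constructor
    · rintro _ ⟨x, hx, rfl⟩
      exact Heyting.Regular.toRegular.monotone fun p hp => le_trans hp (ha.1 hx)
    · intro c hc
      -- As `c` is regular, it suffices to refine each `p` with `p i ≤ a` into `c`; if no
      -- restriction of `p` to a member of `s` were a condition in `c`, then `p` would be separated.
      rw [hgle, ← c.prop.eq]
      refine Unseparated.exists_mem_of_le fun p hp => ?_
      by_contra! hcon
      refine p.2 (BorelSeparated.of_isLUB p.1 i hs ha hp fun x hx => ?_)
      by_contra hsep
      refine hcon ⟨_, hsep⟩ (hupd _ _ _) ((hgle i x c).1 (hc ⟨x, hx, rfl⟩) ?_)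
      change Function.update p.1 i (p.1 i ⊓ x) i ≤ x
      rw [Function.update_self]
      exact inf_le_right
  · refine ⟨⊥, ⊤, fun h => ?_⟩
    have h1 := congrArg Heyting.Regular.val h
    rw [Heyting.Regular.coe_bot, Heyting.Regular.coe_top] at h1
    have h2 : (⟨_, hf⟩ : Unseparated f) ∈ (⊤ : LowerSet (Unseparated f)) := trivial
    rw [← h1] at h2
    exact h2
  -- A condition with `p i ≤ f i a` may be shrunk at `j` to lie below `f j a`; exchanging `i` and
  -- `j` gives equality.
  · have hle : ∀ i j a, g i (f i a) ≤ g j (f j a) := fun i j a => by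
      rw [hgle, Heyting.Regular.coe_toRegular]
      refine Unseparated.exists_mem_of_le fun p hp => ?_
      refine ⟨⟨_, fun hsep => p.2 (BorelSeparated.of_update_inf_map (j := j) hp hsep)⟩,
        hupd _ _ _, ?_⟩
      change Function.update p.1 j (p.1 j ⊓ f j a) j ≤ f j a
      rw [Function.update_self]
      exact inf_le_right
    exact fun i j a => le_antisymm (hle i j a) (hle j i a)

end Amalgamation

/-! ### Free `κ`-Boolean algebras -/

section Free

variable {κ : Cardinal.{u}} {G : Type u}

/-- Terms in the language of `κ`-Boolean algebras. -/
inductive KBoolTerm (κ : Cardinal.{u}) (G : Type u) : Type u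
  | gen (g : G) : KBoolTerm κ G
  | top : KBoolTerm κ G
  | bot : KBoolTerm κ G
  | compl (t : KBoolTerm κ G) : KBoolTerm κ G
  | sup (s t : KBoolTerm κ G) : KBoolTerm κ G
  | inf (s t : KBoolTerm κ G) : KBoolTerm κ G
  -- Subsets of `κ.out` of size `< κ` are enough to index all `κ`-ary joins, and they keep the terms
  -- in `Type u`.
  | iSup (S : Set κ.out) (hS : #S < κ) (t : S → KBoolTerm κ G) : KBoolTerm κ G

/-- The value of a term. -/
noncomputable def KBoolTerm.eval {B : Type u} [BooleanAlgebra B] [KComplete κ B] (v : G → B) :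
    KBoolTerm κ G → B
  | gen g => v g
  | top => ⊤
  | bot => ⊥
  | compl t => (t.eval v)ᶜ
  | sup s t => s.eval v ⊔ t.eval v
  | inf s t => s.eval v ⊓ t.eval v
  | iSup _ hS t => kSup hS fun i => (t i).eval v

instance KBoolTerm.setoid (κ : Cardinal.{u}) (G : Type u) : Setoid (KBoolTerm κ G) where
  r s t := ∀ (B : Type u) [BooleanAlgebra B] [KComplete κ B] (v : G → B), s.eval v = t.eval v
  iseqv :=
    { refl := fun _ _ _ _ _ => rfl
      symm := fun h B _ _ v => (h B v).symm
      trans := fun h h' B _ _ v => (h B v).trans (h' B v) }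

/-- The free `κ`-Boolean algebra on `G`: terms modulo equality under all valuations. -/
def FreeKBool (κ : Cardinal.{u}) (G : Type u) : Type u :=
  Quotient (KBoolTerm.setoid κ G)

namespace FreeKBool

/-- The element named by a term. -/
def mk (t : KBoolTerm κ G) : FreeKBool κ G := Quotient.mk _ t

/-- The value of an element of the free algebra. -/
noncomputable def eval {B : Type u} [BooleanAlgebra B] [KComplete κ B] (v : G → B) :
    FreeKBool κ G → B :=
  Quotient.lift (KBoolTerm.eval v) fun _ _ h => h B v

theorem ext {x y : FreeKBool κ G}
    (h : ∀ (B : Type u) [BooleanAlgebra B] [KComplete κ B] (v : G → B), eval v x = eval v y) :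
    x = y := by
  induction x using Quotient.ind
  induction y using Quotient.ind
  exact Quotient.sound h

instance : PartialOrder (FreeKBool κ G) where
  le x y := ∀ (B : Type u) [BooleanAlgebra B] [KComplete κ B] (v : G → B), eval v x ≤ eval v y
  le_refl _ _ _ _ _ := le_rfl
  le_trans _ _ _ h h' B _ _ v := (h B v).trans (h' B v)
  le_antisymm _ _ h h' := ext fun B _ _ v => (h B v).antisymm (h' B v)

/-- Binary joins. -/
protected def sup : FreeKBool κ G → FreeKBool κ G → FreeKBool κ G :=
  Quotient.map₂ KBoolTerm.sup fun _ _ h _ _ h' B _ _ v => congrArg₂ (· ⊔ ·) (h B v) (h' B v)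

/-- Binary meets. -/
protected def inf : FreeKBool κ G → FreeKBool κ G → FreeKBool κ G :=
  Quotient.map₂ KBoolTerm.inf fun _ _ h _ _ h' B _ _ v => congrArg₂ (· ⊓ ·) (h B v) (h' B v)

/-- Complements. -/
protected def compl : FreeKBool κ G → FreeKBool κ G :=
  Quotient.map KBoolTerm.compl fun _ _ h B _ _ v => congrArg Compl.compl (h B v)

variable {B : Type u} [BooleanAlgebra B] [KComplete κ B]

theorem eval_sup (v : G → B) (x y : FreeKBool κ G) : eval v (x.sup y) = eval v x ⊔ eval v y := by
  induction x using Quotient.ind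
  induction y using Quotient.ind
  rfl

theorem eval_inf (v : G → B) (x y : FreeKBool κ G) : eval v (x.inf y) = eval v x ⊓ eval v y := by
  induction x using Quotient.ind
  induction y using Quotient.ind
  rfl

theorem eval_compl (v : G → B) (x : FreeKBool κ G) : eval v x.compl = (eval v x)ᶜ := by
  induction x using Quotient.ind
  rfl

instance : Lattice (FreeKBool κ G) where
  sup := FreeKBool.sup
  inf := FreeKBool.inf
  le_sup_left x y B _ _ v := by rw [eval_sup]; exact le_sup_left
  le_sup_right x y B _ _ v := by rw [eval_sup]; exact le_sup_right
  sup_le x y z h h' B _ _ v := by rw [eval_sup]; exact sup_le (h B v) (h' B v)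
  inf_le_left x y B _ _ v := by rw [eval_inf]; exact inf_le_left
  inf_le_right x y B _ _ v := by rw [eval_inf]; exact inf_le_right
  le_inf x y z h h' B _ _ v := by rw [eval_inf]; exact le_inf (h B v) (h' B v)

instance : BooleanAlgebra (FreeKBool κ G) where
  top := mk .top
  bot := mk .bot
  compl := FreeKBool.compl
  le_sup_inf x y z B _ _ v := by
    have h := le_sup_inf (x := eval v x) (y := eval v y) (z := eval v z)
    rwa [← eval_sup, ← eval_sup, ← eval_inf, ← eval_inf, ← eval_sup] at h
  inf_compl_le_bot x B _ _ v :=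
    ((eval_inf v x x.compl).trans (by rw [eval_compl, inf_compl_self])).trans_le bot_le
  top_le_sup_compl x B _ _ v :=
    le_top.trans_eq ((eval_sup v x x.compl).trans (by rw [eval_compl, sup_compl_eq_top])).symm
  le_top x B _ _ v := le_top (a := eval v x)
  bot_le x B _ _ v := bot_le (a := eval v x)

/-- Joins in the free algebra of families indexed by small subsets of `κ`. -/
noncomputable def iSup (S : Set κ.out) (hS : #S < κ) (t : S → FreeKBool κ G) : FreeKBool κ G :=
  mk (.iSup S hS fun i => (t i).out)

theorem isLUB_eval_iSup (v : G → B) (S : Set κ.out) (hS : #S < κ) (t : S → FreeKBool κ G) :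
    IsLUB (Set.range fun i => eval v (t i)) (eval v (iSup S hS t)) := by
  have h : ∀ i, (t i).out.eval v = eval v (t i) := fun i =>
    congrArg (eval v) (Quotient.out_eq (t i))
  simp only [← h]
  exact isLUB_kSup hS _

/-- Embedding `s` in `κ.out` turns it into the argument of a formal join. All evaluations preserve
this join, which gives both the completeness of the free algebra and the fact that `lift` is a
homomorphism. -/
theorem exists_isLUB_eval (s : Set (FreeKBool κ G)) (hs : #s < κ) :
    ∃ a, IsLUB s a ∧ ∀ (B : Type u) [BooleanAlgebra B] [KComplete κ B] (v : G → B),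
      IsLUB (eval v '' s) (eval v a) := by
  obtain ⟨e⟩ : #s ≤ #κ.out := by rw [Cardinal.mk_out]; exact hs.le
  let e' := Equiv.ofInjective e e.injective
  let t : Set.range e → FreeKBool κ G := fun i => (e'.symm i).1
  have ht : Set.range t = s := by
    change Set.range (Subtype.val ∘ e'.symm) = s
    rw [EquivLike.range_comp, Subtype.range_coe]
  have key : ∀ (B : Type u) [BooleanAlgebra B] [KComplete κ B] (v : G → B),
      IsLUB (eval v '' s) (eval v (iSup _ (Cardinal.mk_range_le.trans_lt hs) t)) :=
    fun B _ _ v => by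
      conv_lhs => rw [← ht, ← Set.range_comp]
      exact isLUB_eval_iSup v _ _ t
  refine ⟨_, ⟨fun x hx B _ _ v => (key B v).1 ⟨x, hx, rfl⟩, fun c hc B _ _ v => ?_⟩, key⟩
  refine (key B v).2 ?_
  rintro _ ⟨x, hx, rfl⟩
  exact hc hx B v

instance : KComplete κ (FreeKBool κ G) where
  exists_isLUB s hs := (exists_isLUB_eval s hs).imp fun _ h => h.1

/-- The generators. -/
def of (κ : Cardinal.{u}) (g : G) : FreeKBool κ G := mk (.gen g)

/-- The homomorphism extending a valuation of the generators. -/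
noncomputable def lift (v : G → B) : KBoolHom κ (FreeKBool κ G) B where
  toFun := eval v
  map_sup' := eval_sup v
  map_inf' := eval_inf v
  map_top' := rfl
  map_bot' := rfl
  map_isLUB' s a hs ha := by
    obtain ⟨b, hb, hb'⟩ := exists_isLUB_eval s hs
    obtain rfl := ha.unique hb
    exact hb' B v

theorem isFreeKBool_of (κ : Cardinal.{u}) (G : Type u) : IsFreeKBool κ (of κ : G → _) := by
  intro B _ _ v
  refine ⟨lift v, fun _ => rfl, fun h hh => KBoolHom.ext fun x => ?_⟩
  induction x using Quotient.ind with | _ t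
  change h (mk t) = t.eval v
  induction t with
  | gen g => exact hh g
  | top => exact map_top h
  | bot => exact map_bot h
  | compl t ih => exact (map_compl' h (mk t)).trans (congrArg Compl.compl ih)
  | sup s t ihs iht =>
    exact (h.map_sup' (mk s) (mk t)).trans (congrArg₂ _ ihs iht)
  | inf s t ihs iht =>
    exact (h.map_inf' (mk s) (mk t)).trans (congrArg₂ _ ihs iht)
  | iSup S hS t ih =>
    -- The formal join is a true least upper bound in the quotient, so `h` must preserve it.
    have h1 : IsLUB (Set.range fun i => mk (t i))
        (mk (.iSup S hS t)) := by
      constructor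
      · rintro _ ⟨i, rfl⟩ C _ _ w
        exact (isLUB_kSup hS fun i => (t i).eval w).1 ⟨i, rfl⟩
      · intro c hc C _ _ w
        refine (isLUB_kSup hS fun i => (t i).eval w).2 ?_
        rintro _ ⟨i, rfl⟩
        exact hc ⟨i, rfl⟩ C w
    have h2 := h.map_isLUB_range hS h1
    simp only [ih] at h2
    exact h2.unique (isLUB_kSup hS _)

end FreeKBool

theorem isKPresented_freeKBool (hκ : κ.IsRegular) (hG : #G < κ) :
    IsKPresented κ (FreeKBool κ G) := by
  refine ⟨G, FreeKBool κ G, inferInstance, inferInstance, FreeKBool.of κ, ∅, KBoolHom.id κ _, hG,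
    ?_, FreeKBool.isFreeKBool_of κ G, Function.surjective_id, by simp, fun B _ _ h _ => ⟨h, rfl⟩⟩
  rw [Cardinal.mk_eq_zero]
  exact hκ.pos

end Free

/-! ### Amalgamation of `κ`-presented algebras -/

section StandardAmalgamation

variable {κ : Cardinal.{u}} {A B ι : Type u} [BooleanAlgebra A] [BooleanAlgebra B]

theorem KBoolHom.map_kInf_eq_top [KComplete κ A] (h : KBoolHom κ A B) (hι : #ι < κ) {f : ι → A}
    (hf : ∀ i, h (f i) = ⊤) : h (kInf hι f) = ⊤ :=
  top_le_iff.1 <| (h.map_isGLB_range hι (isGLB_kInf hι f)).2 <| by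
    rintro _ ⟨i, rfl⟩
    exact (hf i).ge

/-- This makes quotients by fewer than `κ` relations principal: the relations hold below the meet of
their biimplications. -/
theorem restrictHom_eq_of_le_bihimp {b x y : A} (h : b ≤ bihimp x y) :
    restrictHom κ b x = restrictHom κ b y := by
  rw [bihimp_def, le_inf_iff, le_himp_iff, le_himp_iff] at h
  exact Subtype.ext (le_antisymm (le_inf inf_le_left h.2) (le_inf inf_le_left h.1))

theorem KBoolHom.nontrivial (h : KBoolHom κ A B) [Nontrivial B] : Nontrivial A :=
  ⟨⊥, ⊤, fun e => bot_ne_top (α := B) (by rw [← map_bot h, e, map_top])⟩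

theorem IsFreeKBool.hom_ext {G F : Type u} [BooleanAlgebra F] {i : G → F} (hi : IsFreeKBool κ i)
    [KComplete κ B] {h k : KBoolHom κ F B} (hk : ∀ g, h (i g) = k (i g)) : h = k :=
  (hi B fun g => k (i g)).unique hk fun _ => rfl

/-- `κ`-presented algebras `B i` over a `κ`-presented algebra `A` that are not separated have a
nontrivial `κ`-presented amalgam. -/
theorem exists_kPresented_amalgam (hκ : κ.IsRegular) [KComplete κ A] (hA : IsKPresented κ A)
    {B : ι → Type u} [∀ i, BooleanAlgebra (B i)] (hB : ∀ i, IsKPresented κ (B i)) (hι : #ι < κ)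
    (f : ∀ i, KBoolHom κ A (B i)) (hf : ¬ BorelSeparated f fun _ => ⊤) :
    ∃ (E : Type u) (_ : BooleanAlgebra E) (_ : KComplete κ E) (g : ∀ i, KBoolHom κ (B i) E),
      IsKPresented κ E ∧ Nontrivial E ∧ ∀ i j a, g i (f i a) = g j (f j a) := by
  obtain ⟨E, _, _, g, _, hg⟩ := exists_amalgam hκ.aleph0_le f hf
  obtain ⟨GA, FA, _, _, genA, -, qA, hGA, -, hfreeA, hqA, -⟩ := hA
  choose G F _ _ gen R q hG hR hfree hq using hB
  -- `t i z` is a word in the generators of `B i` naming the image of the generator `z` of `A`.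
  choose t ht using fun i z => (hq i).1 (f i (qA (genA z)))
  choose j hj _ using fun i => hfree i (FreeKBool κ (Σ i, G i)) fun x => FreeKBool.of κ ⟨i, x⟩
  let h : KBoolHom κ (FreeKBool κ (Σ i, G i)) E :=
    FreeKBool.lift fun x => g x.1 (q x.1 (gen x.1 x.2))
  have hhj : ∀ i x, h (j i x) = g i (q i x) := fun i x => by
    have : h.comp (j i) = (g i).comp (q i) := (hfree i).hom_ext fun z => by
      rw [KBoolHom.comp_apply, hj]
      rfl
    exact DFunLike.congr_fun this x
  -- `b₁` imposes the relations of every `B i`, and `b₂` identifies the names of each generator of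
  -- `A` in the different `B i`.
  let b₁ := kInf hι fun i => kInf (hR i) fun r => bihimp (j i r.1.1) (j i r.1.2)
  let b₂ := kInf hι fun i => kInf hι fun i' => kInf hGA fun z => bihimp (j i (t i z)) (j i' (t i' z))
  -- All these equations hold in the forcing extension `E`, so `h` descends to the principal
  -- quotient and shows it nontrivial.
  have hb : h (b₁ ⊓ b₂) = ⊤ := by
    rw [map_inf, inf_eq_top_iff]
    constructor
    · refine h.map_kInf_eq_top hι fun i => h.map_kInf_eq_top _ fun r => ?_
      rw [map_bihimp, bihimp_eq_top, hhj, hhj, (hq i).2.1 _ r.2]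
    · refine h.map_kInf_eq_top hι fun i => h.map_kInf_eq_top hι fun i' =>
        h.map_kInf_eq_top _ fun z => ?_
      rw [map_bihimp, bihimp_eq_top, hhj, hhj, ht, ht, hg]
  have hG' : #(Σ i, G i) < κ := by
    rw [Cardinal.mk_sigma]
    exact Cardinal.sum_lt_of_isRegular hκ hι hG
  choose k hk using fun i => (hq i).2.2 _ ((restrictHom κ (b₁ ⊓ b₂)).comp (j i)) fun r hr =>
    restrictHom_eq_of_le_bihimp (κ := κ) <| inf_le_left.trans <| (kInf_le hι _ i).trans <|
      kInf_le (hR i) (fun r => bihimp (j i r.1.1) (j i r.1.2)) ⟨r, hr⟩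
  have : Fact κ.IsRegular := ⟨hκ⟩
  refine ⟨Set.Iic (b₁ ⊓ b₂), inferInstance, inferInstance, k,
    (isKPresented_freeKBool hκ hG').iic _, (descendHom h _ hb).nontrivial, fun i i' a => ?_⟩
  obtain ⟨a, rfl⟩ := hqA a
  have hcomp : (((k i).comp (f i)).comp qA) = (((k i').comp (f i')).comp qA) :=
    hfreeA.hom_ext fun z => by
      simp only [KBoolHom.comp_apply]
      rw [← ht, ← ht]
      refine (DFunLike.congr_fun (hk i) _).trans (Eq.trans ?_ (DFunLike.congr_fun (hk i') _).symm)
      exact restrictHom_eq_of_le_bihimp (κ := κ) <| inf_le_right.trans <| (kInf_le hι _ i).trans <|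
        (kInf_le hι _ i').trans <| kInf_le hGA _ z
  exact DFunLike.congr_fun hcomp a

end StandardAmalgamation

/-! ### Images -/

section Image

variable {κ : Cardinal.{u}} {A B : Type u} [BooleanAlgebra A] [BooleanAlgebra B]

/-- The image of a homomorphism. -/
def KBoolHom.range (h : KBoolHom κ A B) : BooleanSubalgebra B :=
  (⊤ : BooleanSubalgebra A).map h.toBoundedLatticeHom

theorem KBoolHom.apply_mem_range (h : KBoolHom κ A B) (a : A) : h a ∈ h.range :=
  ⟨a, trivial, rfl⟩

theorem isLUB_of_isLUB_coe {L : BooleanSubalgebra B} {s : Set L} {a : L}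
    (h : IsLUB (Subtype.val '' s) a.1) : IsLUB s a :=
  ⟨fun x hx => h.1 ⟨x, hx, rfl⟩, fun _ hc => h.2 (by rintro _ ⟨x, hx, rfl⟩; exact hc hx)⟩

/-- Lifting `s` to `A` and taking the join there shows that the image is closed under `κ`-ary joins
computed in `B`. -/
theorem KBoolHom.exists_isLUB_coe_range [KComplete κ A] (h : KBoolHom κ A B) {s : Set h.range}
    (hs : #s < κ) : ∃ a : h.range, IsLUB (Subtype.val '' s) a.1 := by
  choose t _ ht using fun x : h.range => x.2
  have ht' : #(t '' s) < κ := Cardinal.mk_image_le.trans_lt hs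
  obtain ⟨a, ha⟩ := KComplete.exists_isLUB (κ := κ) (t '' s) ht'
  have h1 := h.map_isLUB ht' ha
  rw [Set.image_image] at h1
  refine ⟨⟨h a, h.apply_mem_range a⟩, ?_⟩
  have hst : (fun x => h (t x)) '' s = Subtype.val '' s := Set.image_congr fun x _ => ht x
  rwa [hst] at h1

theorem KBoolHom.kComplete_range [KComplete κ A] (h : KBoolHom κ A B) : KComplete κ h.range where
  exists_isLUB _ hs := (h.exists_isLUB_coe_range hs).imp fun _ => isLUB_of_isLUB_coe

/-- The inclusion of the image. -/
def KBoolHom.rangeInclusion [KComplete κ A] (h : KBoolHom κ A B) : KBoolHom κ h.range B where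
  toFun := Subtype.val
  map_sup' _ _ := rfl
  map_inf' _ _ := rfl
  map_top' := rfl
  map_bot' := rfl
  map_isLUB' s a hs ha := by
    obtain ⟨b, hb⟩ := h.exists_isLUB_coe_range hs
    obtain rfl := ha.unique (isLUB_of_isLUB_coe hb)
    exact hb

/-- The corestriction of a homomorphism to its image. -/
def KBoolHom.rangeRestrict (h : KBoolHom κ A B) : KBoolHom κ A h.range where
  toFun a := ⟨h a, h.apply_mem_range a⟩
  map_sup' x y := Subtype.ext (map_sup h x y)
  map_inf' x y := Subtype.ext (map_inf h x y)
  map_top' := Subtype.ext (map_top h)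
  map_bot' := Subtype.ext (map_bot h)
  map_isLUB' s a hs ha := isLUB_of_isLUB_coe <| by
    rw [Set.image_image]
    exact h.map_isLUB hs ha

theorem KBoolHom.rangeRestrict_surjective (h : KBoolHom κ A B) :
    Function.Surjective h.rangeRestrict := by
  rintro ⟨_, a, _, rfl⟩
  exact ⟨a, rfl⟩

end Image

/-! ### Analytic `κ`-Borel locales -/

section Analytic

variable {κ : Cardinal.{u}}

theorem BorelLocale.IsStandard.isAnalytic {X : BorelLocale κ} (hX : X.IsStandard) :
    BorelLocale.IsAnalytic κ X :=
  ⟨X, X, 𝟙 X, 𝟙 X, 𝟙 X, hX, hX, Category.comp_id _, Function.injective_id, Function.surjective_id⟩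

namespace AnalyticBorelLocale

variable {X Y W : AnalyticBorelLocale κ}

/-- The inverse image homomorphism of a `κ`-Borel map. -/
def preimage (f : X ⟶ Y) : KBoolHom κ (BorelSet Y) (BorelSet X) := BorelMap.preimage f.hom

/-- The `κ`-Borel map with a given inverse image homomorphism. -/
def ofPreimage (h : KBoolHom κ (BorelSet Y) (BorelSet X)) : X ⟶ Y :=
  ObjectProperty.homMk (show X.obj ⟶ Y.obj from BorelMap.mk h)

theorem hom_ext {f g : X ⟶ Y} (h : ∀ b, preimage f b = preimage g b) : f = g :=
  ObjectProperty.hom_ext _ (BorelMap.ext (KBoolHom.ext h))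

theorem preimage_comp (f : X ⟶ Y) (g : Y ⟶ W) (b : BorelSet W) :
    preimage (f ≫ g) b = preimage f (preimage g b) := rfl

/-- An analytic locale is the image of a standard one. -/
theorem exists_injective (X : AnalyticBorelLocale κ) :
    ∃ (E : Type u) (_ : BooleanAlgebra E) (e : KBoolHom κ (BorelSet X) E),
      IsKPresented κ E ∧ Function.Injective e := by
  obtain ⟨Y, Z, p, e, m, hY, -, -, he, -⟩ := X.property
  exact ⟨Y.Borel, inferInstance, BorelMap.preimage e, hY, he⟩

/-- The image of a `κ`-Borel map from a standard to an analytic locale is analytic. -/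
theorem isAnalytic_range (X : AnalyticBorelLocale κ) {E : Type u} [BooleanAlgebra E]
    [KComplete κ E] (hE : IsKPresented κ E) (w : KBoolHom κ (BorelSet X) E) :
    BorelLocale.IsAnalytic κ
      { Borel := w.range, kComplete := w.kComplete_range : BorelLocale κ } := by
  obtain ⟨Y, Z, p, e, m, -, hZ, -, -, hm⟩ := X.property
  have := w.kComplete_range
  let i : BorelLocale.mk (κ := κ) E ⟶ BorelLocale.mk w.range := BorelMap.mk w.rangeInclusion
  let r : BorelLocale.mk w.range ⟶ X.obj := BorelMap.mk w.rangeRestrict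
  exact ⟨_, Z, i ≫ r ≫ m, i, r ≫ m, hE, hZ, rfl, Subtype.val_injective,
    w.rangeRestrict_surjective.comp hm⟩

/-- Standard locales over an analytic one that are not separated have a nonempty standard
locale mapping to their fiber product. -/
theorem exists_kPresented_amalgam (hκ : κ.IsRegular) (X : AnalyticBorelLocale κ) {ι : Type u}
    (hι : #ι < κ) {B : ι → Type u} [∀ i, BooleanAlgebra (B i)] (hB : ∀ i, IsKPresented κ (B i))
    (f : ∀ i, KBoolHom κ (BorelSet X) (B i)) (hf : ¬ BorelSeparated f fun _ => ⊤) :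
    ∃ (E : Type u) (_ : BooleanAlgebra E) (_ : KComplete κ E) (g : ∀ i, KBoolHom κ (B i) E),
      IsKPresented κ E ∧ Nontrivial E ∧ ∀ i j a, g i (f i a) = g j (f j a) := by
  obtain ⟨Y, Z, p, e, m, -, hZ, -, -, hm⟩ := X.property
  let m' : KBoolHom κ Z.Borel (BorelSet X) := BorelMap.preimage m
  -- The base is enlarged to the standard `Z` in which `X` embeds. Separators in `Z` restrict to
  -- `X`, and agreement over `Z` gives agreement over `X` because `m'` is surjective.
  obtain ⟨E, _, _, g, hE, hE', hg⟩ :=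
    _root_.exists_kPresented_amalgam hκ hZ hB hι (fun i => (f i).comp m') <| by
      rintro ⟨a, ha, ha'⟩
      refine hf ⟨fun i => m' (a i), ha, ?_⟩
      rw [← map_bot m']
      exact m'.map_isGLB_range hι ha'
  refine ⟨E, inferInstance, inferInstance, g, hE, hE', fun i j a => ?_⟩
  obtain ⟨a, rfl⟩ := hm a
  exact hg i j a

/-- Monomorphisms of analytic locales are embeddings. -/
theorem preimage_surjective (hκ : κ.IsRegular) (m : X ⟶ Y) [Mono m] :
    Function.Surjective (preimage m) := by
  intro a
  obtain ⟨S, _, e, hS, he⟩ := X.exists_injective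
  have hele : ∀ {x y}, e x ≤ e y → x ≤ y := fun {x y} h => by
    rw [← inf_eq_left, ← map_inf] at h
    exact inf_eq_left.1 (he h)
  -- The parts of the standard cover `S` over `a` and over `aᶜ` are compared as locales over `Y`.
  let s : ULift.{u} Bool → BorelSet X := fun i => cond i.down a aᶜ
  have : Fact κ.IsRegular := ⟨hκ⟩
  by_contra hcon
  obtain ⟨E, _, _, g, hE, _, hg⟩ := Y.exists_kPresented_amalgam hκ (ι := ULift.{u} Bool)
    ((Cardinal.lt_aleph0_of_finite _).trans_le hκ.aleph0_le) (fun i => hS.iic (e (s i)))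
    (fun i => (restrictHom κ (e (s i))).comp (e.comp (preimage m))) <| by
      rintro ⟨b, hb, hb'⟩
      have hb'' : ∀ i, s i ≤ preimage m (b i) := fun i => hele (le_inf_iff.1 (hb i)).2
      have hbot : b ⟨true⟩ ⊓ b ⟨false⟩ = ⊥ := isGLB_range_bot_iff.1 hb' _ <| by
        rintro ⟨_ | _⟩
        exacts [inf_le_right, inf_le_left]
      -- Disjoint Borel sets of `Y` whose inverse images contain `a` and `aᶜ` have exactly these
      -- inverse images.
      refine hcon ⟨b ⟨true⟩, le_antisymm ?_ (hb'' ⟨true⟩)⟩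
      have h1 : Disjoint (preimage m (b ⟨true⟩)) (preimage m (b ⟨false⟩)) := by
        rw [disjoint_iff, ← map_inf, hbot, map_bot]
      have h2 := (h1.mono_right (hb'' ⟨false⟩)).le_compl_right
      rwa [show (s ⟨false⟩)ᶜ = a from compl_compl a] at h2
  let P : AnalyticBorelLocale κ := ⟨⟨E⟩, BorelLocale.IsStandard.isAnalytic hE⟩
  let v : ULift.{u} Bool → (P ⟶ X) := fun i =>
    ofPreimage ((g i).comp ((restrictHom κ (e (s i))).comp e))
  -- Without separators, a nonempty `P` has two maps to `X`, one landing in `a` and one in `aᶜ`,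
  -- which agree after `m` and are therefore equal.
  have hv : v ⟨true⟩ = v ⟨false⟩ := (cancel_mono m).1 (hom_ext fun b => hg _ _ b)
  have hvs : ∀ i, preimage (v i) (s i) = ⊤ := fun i => by
    change g i (restrictHom κ (e (s i)) (e (s i))) = ⊤
    rw [show restrictHom κ (e (s i)) (e (s i)) = ⊤ from Subtype.ext (inf_idem _), map_top]
  have h1 : preimage (v ⟨true⟩) a = ⊤ := hvs ⟨true⟩
  have h2 : preimage (v ⟨false⟩) aᶜ = ⊤ := hvs ⟨false⟩
  rw [← hv, map_compl', h1, compl_top] at h2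
  exact bot_ne_top (α := E) h2

end AnalyticBorelLocale

end Analytic

/-! ### Analytic sets -/

namespace AnalyticSet

open AnalyticBorelLocale

variable {κ : Cardinal.{u}} [hκ : Fact κ.IsRegular] {X : AnalyticBorelLocale κ}

/-- Monomorphisms being embeddings, a subobject is a quotient algebra of `BorelSet X`, and a
quotient is determined by the elements it sends to `⊤`. -/
theorem mk_le_mk_iff {Y W : AnalyticBorelLocale κ} {f : Y ⟶ X} {g : W ⟶ X} [Mono f] [Mono g] :
    Subobject.mk f ≤ Subobject.mk g ↔ ∀ b, preimage g b = ⊤ → preimage f b = ⊤ := by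
  constructor
  · intro h b hb
    rw [← Subobject.ofMkLEMk_comp h, preimage_comp, hb, map_top]
  · intro h
    obtain ⟨k, hk⟩ := (preimage g).exists_comp_eq_of_surjective hκ.out.aleph0_le
      (preimage_surjective hκ.out g) (preimage f) h
    exact Subobject.mk_le_mk_of_comm (ofPreimage k) (hom_ext fun b => DFunLike.congr_fun hk b)

theorem mk_le_ofBorel_iff {Y : AnalyticBorelLocale κ} {f : Y ⟶ X} [Mono f] {b : BorelSet X} :
    Subobject.mk f ≤ ofBorel b ↔ preimage f b = ⊤ := by
  have hb : ∀ c, preimage (X.subι b) c = ⊤ ↔ b ≤ c := fun c =>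
    Subtype.ext_iff.trans inf_eq_left
  simp only [ofBorel, mk_le_mk_iff, hb]
  exact ⟨fun h => h b le_rfl, fun h c hc => top_le_iff.1 (h ▸ OrderHomClass.mono (preimage f) hc)⟩

theorem le_ofBorel_iff {A : AnalyticSet X} {b : BorelSet X} :
    A ≤ ofBorel b ↔ preimage A.arrow b = ⊤ := by
  rw [← mk_le_ofBorel_iff, Subobject.mk_arrow]

/-- An analytic set is determined by the Borel sets containing it. -/
theorem le_iff_forall_ofBorel {A A' : AnalyticSet X} :
    A ≤ A' ↔ ∀ b, A' ≤ ofBorel b → A ≤ ofBorel b := by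
  simp only [le_ofBorel_iff]
  rw [← mk_le_mk_iff, Subobject.mk_arrow, Subobject.mk_arrow]

theorem ofBorel_le_ofBorel {b c : BorelSet X} : ofBorel b ≤ ofBorel c ↔ b ≤ c :=
  mk_le_ofBorel_iff.trans (Subtype.ext_iff.trans inf_eq_left)

theorem le_ofBorel_inf {A : AnalyticSet X} {b c : BorelSet X} (hb : A ≤ ofBorel b)
    (hc : A ≤ ofBorel c) : A ≤ ofBorel (b ⊓ c) := by
  rw [le_ofBorel_iff] at *
  rw [map_inf, hb, hc, inf_idem]

theorem ofBorel_top : ofBorel (⊤ : BorelSet X) = ⊤ :=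
  top_le_iff.1 (le_ofBorel_iff.2 (map_top _))

/-- `C` is the image of the standard locale with algebra `E`, namely the subobject with algebra
`w.range`. -/
theorem exists_image {E : Type u} [BooleanAlgebra E] [KComplete κ E] (hE : IsKPresented κ E)
    (w : KBoolHom κ (BorelSet X) E) : ∃ C : AnalyticSet X, ∀ b, C ≤ ofBorel b ↔ w b = ⊤ := by
  let W : AnalyticBorelLocale κ := ⟨_, X.isAnalytic_range hE w⟩
  let r : W ⟶ X := ofPreimage w.rangeRestrict
  have : Mono r := ⟨fun u v huv => hom_ext fun b => by
    obtain ⟨a, rfl⟩ := w.rangeRestrict_surjective b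
    exact DFunLike.congr_fun (congrArg preimage huv) a⟩
  exact ⟨Subobject.mk r, fun b => mk_le_ofBorel_iff.trans Subtype.ext_iff⟩

/-- Novikov separation. -/
theorem exists_borel_of_isGLB_bot {ι : Type u} (hι : #ι < κ) (A : ι → AnalyticSet X)
    (hA : IsGLB (Set.range A) ⊥) :
    ∃ B : ι → BorelSet X, (∀ i, A i ≤ ofBorel (B i)) ∧ IsGLB (Set.range B) ⊥ := by
  choose S _ e hS he using fun i => ((A i : AnalyticSet X) : AnalyticBorelLocale κ).exists_injective
  by_contra hcon
  obtain ⟨E, _, _, g, hE, _, hg⟩ := X.exists_kPresented_amalgam hκ.out hι hS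
    (fun i => (e i).comp (preimage (A i).arrow)) <| by
      rintro ⟨b, hb, hb'⟩
      refine hcon ⟨b, fun i => le_ofBorel_iff.2 (he i ?_), hb'⟩
      rw [map_top]
      exact top_le_iff.1 (hb i)
  rcases isEmpty_or_nonempty ι with _ | ⟨⟨i₀⟩⟩
  -- For the empty family, every Borel set is a lower bound, so `X` itself is empty.
  · refine hcon ⟨isEmptyElim, isEmptyElim, isGLB_range_bot_iff.2 fun x _ => le_bot_iff.1 ?_⟩
    rw [← ofBorel_le_ofBorel]
    exact hA.2 (by rintro _ ⟨i, -⟩; exact isEmptyElim i)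
  -- The composites to `X` agree, so the image `C` lies in every `A i` and is empty, which forces `⊥
  -- = ⊤` in `E`.
  · obtain ⟨C, hC⟩ := exists_image hE ((g i₀).comp ((e i₀).comp (preimage (A i₀).arrow)))
    have hCA : C ≤ ofBorel ⊥ := hA.2 <| by
      rintro _ ⟨i, rfl⟩
      refine le_iff_forall_ofBorel.2 fun b hb => (hC b).2 ((hg i₀ i b).trans ?_)
      rw [le_ofBorel_iff] at hb
      rw [KBoolHom.comp_apply, hb, map_top, map_top]
    exact bot_ne_top (α := E) ((map_bot _).symm.trans ((hC ⊥).1 hCA))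

theorem disjoint_ofBorel {A₁ A₂ : AnalyticSet X} {b c : BorelSet X} (hb : A₁ ≤ ofBorel b)
    (hc : A₂ ≤ ofBorel c) (hbc : b ⊓ c = ⊥) : Disjoint A₁ A₂ :=
  fun _ h₁ h₂ => (le_ofBorel_inf (h₁.trans hb) (h₂.trans hc)).trans_eq (congrArg ofBorel hbc)

/-- Lusin separation. -/
theorem exists_borel_of_disjoint {A₁ A₂ : AnalyticSet X} (h : Disjoint A₁ A₂) :
    ∃ B C : BorelSet X, A₁ ≤ ofBorel B ∧ A₂ ≤ ofBorel C ∧ B ⊓ C = ⊥ := by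
  obtain ⟨B, hB, hB'⟩ := exists_borel_of_isGLB_bot (ι := ULift.{u} Bool)
    ((Cardinal.lt_aleph0_of_finite _).trans_le hκ.out.aleph0_le) (fun i => cond i.down A₁ A₂)
    ⟨fun _ _ => bot_le, fun C hC => h (hC ⟨⟨true⟩, rfl⟩) (hC ⟨⟨false⟩, rfl⟩)⟩
  refine ⟨B ⟨true⟩, B ⟨false⟩, hB ⟨true⟩, hB ⟨false⟩, isGLB_range_bot_iff.1 hB' _ ?_⟩
  rintro ⟨_ | _⟩
  exacts [inf_le_right, inf_le_left]

/-- Codisjointness is tested on Borel sets: one containing an upper bound of both parts contains `b`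
and `bᶜ`, hence is `⊤`. -/
theorem isCompl_ofBorel (b : BorelSet X) : IsCompl (ofBorel b) (ofBorel bᶜ) := by
  refine ⟨disjoint_ofBorel le_rfl le_rfl (inf_compl_self b), fun D h₁ h₂ => ?_⟩
  refine le_iff_forall_ofBorel.2 fun c hc => ?_
  have h₁' := ofBorel_le_ofBorel.1 (h₁.trans hc)
  have h₂' := ofBorel_le_ofBorel.1 (h₂.trans hc)
  rw [← ofBorel_top, ofBorel_le_ofBorel, ← sup_compl_eq_top (x := b)]
  exact sup_le h₁' h₂'

/-- Suslin's theorem. -/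
theorem exists_ofBorel_eq_of_isCompl {A A' : AnalyticSet X} (h : IsCompl A A') :
    ∃ B, ofBorel B = A := by
  obtain ⟨B, C, hB, hC, hBC⟩ := exists_borel_of_disjoint h.disjoint
  -- To see that `B` lies in `A`, let `x` be a Borel set containing `A`. Then `x ⊔ Bᶜ` contains both
  -- `A` and `A'`, so it is `⊤`, and `B ≤ x`.
  refine ⟨B, le_antisymm (le_iff_forall_ofBorel.2 fun x hx => ?_) hB⟩
  have h₁ : A ≤ ofBorel (x ⊔ Bᶜ) := hx.trans (ofBorel_le_ofBorel.2 le_sup_left)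
  have h₂ : A' ≤ ofBorel (x ⊔ Bᶜ) := hC.trans <| ofBorel_le_ofBorel.2 <|
    (disjoint_iff.2 hBC).symm.le_compl_right.trans le_sup_right
  have h₃ := h.codisjoint h₁ h₂
  rw [← ofBorel_top, ofBorel_le_ofBorel, ← himp_eq, le_himp_iff, top_inf_eq] at h₃
  exact ofBorel_le_ofBorel.2 h₃

end AnalyticSet

/-! ### Separation for maps -/

/-- Novikov separation for `κ`-Borel maps. -/
theorem exists_borel_of_isEmptyLocale {κ : Cardinal.{u}} (hκ : κ.IsRegular) (X : BorelLocale κ)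
    (ι : Type u) (Y : ι → BorelLocale κ) (f : ∀ i, Y i ⟶ X)
    (c : Cone (WidePullbackShape.wideCospan X Y f)) (hc : IsLimit c) (hc' : c.pt.IsEmptyLocale) :
    ∃ B : ι → X.Borel, IsGLB (Set.range B) ⊥ ∧ ∀ i, (f i).preimage (B i) = ⊤ := by
  -- The mediating map to the limit would carry nontriviality of any cone to the algebra of the
  -- limit.
  have key : ∀ c' : Cone (WidePullbackShape.wideCospan X Y f), ¬ Nontrivial c'.pt.Borel :=
    fun c' _ => by
      have := (BorelMap.preimage (hc.lift c')).nontrivial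
      exact not_subsingleton _ hc'
  rcases isEmpty_or_nonempty ι with _ | ⟨⟨i₀⟩⟩
  -- The fiber product of no maps is `X`, which is itself the apex of a cone.
  · have hX := key (WidePullbackShape.mkCone (𝟙 X) isEmptyElim isEmptyElim)
    have : Subsingleton X.Borel := not_nontrivial_iff_subsingleton.1 hX
    exact ⟨isEmptyElim, isGLB_range_bot_iff.2 fun _ _ => Subsingleton.elim _ _, isEmptyElim⟩
  · by_contra hcon
    obtain ⟨E, _, _, g, hE, hg⟩ := exists_amalgam hκ.aleph0_le (fun i => (f i).preimage) <| by
      rintro ⟨b, hb, hb'⟩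
      exact hcon ⟨b, hb', fun i => top_le_iff.1 (hb i)⟩
    let v : ∀ i, BorelLocale.mk (κ := κ) E ⟶ Y i := fun i => BorelMap.mk (g i)
    refine key (WidePullbackShape.mkCone (v i₀ ≫ f i₀) v fun i => ?_) hE
    exact BorelMap.ext (KBoolHom.ext fun a => hg i i₀ a)

theorem mainTheorem4 {κ : Cardinal.{u}} [Fact κ.IsRegular] :
    -- Novikov separation for κ-Borel maps between standard κ-Borel locales
    (∀ (X : BorelLocale κ) (ι : Type u) (Y : ι → BorelLocale κ) (f : ∀ i, Y i ⟶ X),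
      X.IsStandard → (∀ i, (Y i).IsStandard) → #ι < κ →
      ∀ c : Cone (WidePullbackShape.wideCospan X Y f), IsLimit c → c.pt.IsEmptyLocale →
        ∃ B : ι → X.Borel, IsGLB (Set.range B) ⊥ ∧ ∀ i, (f i).preimage (B i) = ⊤) ∧
    ∀ X : AnalyticBorelLocale κ,
      -- Novikov separation for κ-analytic sets
      (∀ (ι : Type u) (A : ι → AnalyticSet X), #ι < κ → IsGLB (Set.range A) ⊥ →
        ∃ B : ι → BorelSet X,
          (∀ i, A i ≤ AnalyticSet.ofBorel (B i)) ∧ IsGLB (Set.range B) ⊥) ∧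
      -- Lusin separation
      (∀ A₁ A₂ : AnalyticSet X, Disjoint A₁ A₂ →
        ∃ B : BorelSet X, A₁ ≤ AnalyticSet.ofBorel B ∧ Disjoint A₂ (AnalyticSet.ofBorel B)) ∧
      -- Suslin's theorem: κ-Borel sets are exactly the complemented κ-analytic sets
      (∀ B C : BorelSet X, AnalyticSet.ofBorel B ≤ AnalyticSet.ofBorel C ↔ B ≤ C) ∧
      (∀ A : AnalyticSet X,
        (∃ B : BorelSet X, AnalyticSet.ofBorel B = A) ↔ ∃ A' : AnalyticSet X, IsCompl A A') := by
  refine ⟨fun X ι Y f _ _ _ c hc hc' =>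
    exists_borel_of_isEmptyLocale Fact.out X ι Y f c hc hc', fun X => ?_⟩
  refine ⟨fun ι A hι hA => AnalyticSet.exists_borel_of_isGLB_bot hι A hA, fun A₁ A₂ h => ?_,
    fun B C => AnalyticSet.ofBorel_le_ofBorel, fun A => ⟨?_, ?_⟩⟩
  · obtain ⟨B, C, hB, hC, hBC⟩ := AnalyticSet.exists_borel_of_disjoint h
    exact ⟨B, hB, AnalyticSet.disjoint_ofBorel hC le_rfl (inf_comm C B ▸ hBC)⟩
  · rintro ⟨B, rfl⟩
    exact ⟨_, AnalyticSet.isCompl_ofBorel B⟩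
  · rintro ⟨A', h⟩
    exact AnalyticSet.exists_ofBorel_eq_of_isCompl h
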